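/- All chains and homology are taken with coefficients in $\mathbb{Z}_2$; $\beta_i(X)=\dim_{\mathbb{Z}_2}H_i(X;\mathbb{Z}_2)$ denotes the (non-reduced) $i$-th singular Betti number of a space $X$. For a simplicial complex $K$, $C_*(K)$ is its simplicial chain complex, and for a topological space $\mathbf{R}$, $C_*(\mathbf{R})$ is its singular chain complex. The support of a singular chain is the union of the images of the singular simplices that have a nonzero coefficient in it. A chain map $\gamma\colon C_*(K)\to C_*(\mathbf{R})$ is called nontrivial if the image of every vertex of $K$ is a sum of an odd number of distinct points ($0$-simplices) of $\mathbf{R}$. Let $\mathcal{F}=\{U_1,\dots,U_n\}$ be a finite (indexed) family of subsets of $\mathbf{R}$, and for $I\subseteq[n]=\{1,\dots,n\}$ put $U_{\overline{I}}=\bigcap_{i\in[n]\setminus I}U_i$, where $U_{\overline{[n]}}=\mathbf{R}$. The chain map $\gamma$ is constrained by $\mathcal{F}$ if there is a map $\Phi$ from the set of simplices of $K$ (including the empty simplex) to $2^{[n]}$ such that $\Phi(\emptyset)=\emptyset$, $\Phi(\sigma\cap\tau)=\Phi(\sigma)\cap\Phi(\tau)$ for all $\sigma,\tau\in K$, and for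 every nonempty simplex $\sigma\in K$ the support of $\gamma(\sigma)$ is contained in $U_{\overline{\Phi(\sigma)}}$. Proposition. For every finite simplicial complex $K$ and every non-negative integer $b$ there exists a constant $h_K(b)$ such that the following holds. Let $\mathcal{F}$ be a finite family of at least $h_K(b)$ subsets of a topological space $\mathbf{R}$ such that $\bigcap\mathcal{G}\neq\emptyset$ and $\beta_i(\bigcap\mathcal{G})\le b$ for every proper subfamily $\mathcal{G}\subsetneq\mathcal{F}$ and every $0\le i<\dim K$ (the empty subfamily has intersection $\mathbf{R}$). Then there exists a nontrivial chain map $\gamma\colon C_*(K)\to C_*(\mathbf{R})$ that is constrained by $\mathcal{F}$. -/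

import Mathlib

universe u v

noncomputable section

namespace PreAbstractSimplicialComplex

variable {V : Type v}

/-- The dimension of a simplicial complex, with value `⊥` for the complex without vertices. -/
def dim (K : PreAbstractSimplicialComplex V) : WithBot ℕ∞ :=
  ⨆ σ ∈ K.faces, (((σ.card - 1 : ℕ) : ℕ∞) : WithBot ℕ∞)

/-- The `n`-dimensional simplices of `K`. -/
def Simplex (K : PreAbstractSimplicialComplex V) (n : ℕ) : Type v :=
  {σ : Finset V // σ ∈ K.faces ∧ σ.card = n + 1}

/-- The simplicial `n`-chains of `K` over `ℤ/2`. -/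
abbrev Chain (K : PreAbstractSimplicialComplex V) (n : ℕ) : Type v :=
  K.Simplex n →₀ ZMod 2

/-- The facet of `σ` opposite to the vertex `w`. -/
def Simplex.facet [DecidableEq V] {K : PreAbstractSimplicialComplex V} {n : ℕ}
    (σ : K.Simplex (n + 1)) (w : {w // w ∈ σ.1}) : K.Simplex n :=
  have hcard : (σ.1.erase w.1).card = n + 1 := by
    rw [Finset.card_erase_of_mem w.2, σ.2.2]; rfl
  ⟨σ.1.erase w.1,
    (K.isRelLowerSet_faces σ.2.1).2 (Finset.erase_subset _ _)
      (Finset.card_pos.mp (by rw [hcard]; exact Nat.succ_pos n)),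
    hcard⟩

/-- The simplicial boundary operator over `ℤ/2`: a simplex goes to the sum of its facets. -/
def boundary [DecidableEq V] (K : PreAbstractSimplicialComplex V) (n : ℕ) :
    K.Chain (n + 1) →ₗ[ZMod 2] K.Chain n :=
  Finsupp.linearCombination (ZMod 2) fun σ =>
    ∑ w : {w // w ∈ σ.1}, Finsupp.single (σ.facet w) 1

end PreAbstractSimplicialComplex

namespace SingularMod2

/-- The coefficients `ℤ/2`, as a module in the universe of the spaces. -/
abbrev coefficients : ModuleCat.{u} (ZMod 2) :=
  ModuleCat.of (ZMod 2) (ULift.{u} (ZMod 2))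

/-- The singular chain complex of `X` over `ℤ/2`. -/
abbrev complex (X : Type u) [TopologicalSpace X] : ChainComplex (ModuleCat.{u} (ZMod 2)) ℕ :=
  ((AlgebraicTopology.singularChainComplexFunctor (ModuleCat.{u} (ZMod 2))).obj
    coefficients).obj (TopCat.of X)

/-- The (non-reduced) `i`-th Betti number of `X` over `ℤ/2`, as a cardinal. -/
def betti (i : ℕ) (X : Type u) [TopologicalSpace X] : Cardinal.{u} :=
  Module.rank (ZMod 2)
    (((AlgebraicTopology.singularHomologyFunctor (ModuleCat.{u} (ZMod 2)) i).obj
      coefficients).obj (TopCat.of X))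

/-- The singular `n`-simplices of `X`. -/
abbrev Simplex (X : Type u) [TopologicalSpace X] (n : ℕ) : Type u :=
  C(stdSimplex ℝ (Fin (n + 1)), X)

variable {X : Type u} [TopologicalSpace X]

/-- The coefficients of a singular chain: the linear map that sends the generator of the
singular chain group attached to a singular simplex `s` to the basis vector at `s`. -/
def coeff (n : ℕ) : (complex X).X n →ₗ[ZMod 2] (Simplex X n →₀ ZMod 2) :=
  ((TopCat.toSSet.obj (TopCat.of X)).isColimitChainComplexXCofan
    coefficients n).desc
      (CategoryTheory.Limits.Cofan.mk (ModuleCat.of (ZMod 2) (Simplex X n →₀ ZMod 2)) fun s =>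
        ModuleCat.ofHom
          ((Finsupp.lsingle ((TopCat.of X).toSSetObjEquiv _ s)).comp
            (ULift.moduleEquiv : ULift.{u} (ZMod 2) ≃ₗ[ZMod 2] ZMod 2).toLinearMap)) |>.hom

/-- The support of a singular chain: the union of the images of the singular simplices that
have a nonzero coefficient in it. -/
def support {n : ℕ} (c : (complex X).X n) : Set X :=
  ⋃ s ∈ (coeff n c).support, Set.range s

end SingularMod2

/-- Chain maps, over `ℤ/2`, from the simplicial chains of `K` to the singular chains of `X`. -/
structure SimplicialToSingular {V : Type v} [DecidableEq V] (K : PreAbstractSimplicialComplex V)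
    (X : Type u) [TopologicalSpace X] where
  /-- The homomorphism in degree `n`. -/
  map (n : ℕ) : K.Chain n →ₗ[ZMod 2] (SingularMod2.complex X).X n
  /-- The homomorphisms commute with the boundary operators. -/
  comm (n : ℕ) (c : K.Chain (n + 1)) :
    (SingularMod2.complex X).d (n + 1) n (map (n + 1) c) = map n (K.boundary n c)

namespace SimplicialToSingular

variable {V : Type v} [DecidableEq V] {K : PreAbstractSimplicialComplex V}
  {X : Type u} [TopologicalSpace X]

/-- The image of a simplex of `K`. -/
def onSimplex (γ : SimplicialToSingular K X) {n : ℕ} (σ : K.Simplex n) :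
    (SingularMod2.complex X).X n :=
  γ.map n (Finsupp.single σ 1)

/-- The image of every vertex is a sum of an odd number of points. -/
def Nontrivial (γ : SimplicialToSingular K X) : Prop :=
  ∀ w : K.Simplex 0, Odd (SingularMod2.coeff 0 (γ.onSimplex w)).support.card

/-- `γ` is constrained by the family `U` and the map `Φ`. Only the values of `Φ` at the
simplices of `K`, the empty one included, matter; if `Φ σ` is everything then the
intersection below is the whole space. -/
structure ConstrainedByMap (γ : SimplicialToSingular K X) {n : ℕ} (U : Fin n → Set X)
    (Φ : Finset V → Finset (Fin n)) : Prop where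
  map_empty : Φ ∅ = ∅
  map_inter : ∀ σ ∈ K.faces, ∀ τ ∈ K.faces, Φ (σ ∩ τ) = Φ σ ∩ Φ τ
  support_subset : ∀ (k : ℕ) (σ : K.Simplex k),
    SingularMod2.support (γ.onSimplex σ) ⊆ ⋂ i ∈ (Φ σ.1)ᶜ, U i

/-- `γ` is constrained by the family `U`. -/
def ConstrainedBy (γ : SimplicialToSingular K X) {n : ℕ} (U : Fin n → Set X) : Prop :=
  ∃ Φ : Finset V → Finset (Fin n), γ.ConstrainedByMap U Φ

end SimplicialToSingular

end

/-! Embed `K` in a simplex and construct, by induction on `k`, a constrained chain map on the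
`k`-skeleton of a simplex with any prescribed number of vertices. For `k = 0` each vertex goes to a
point that may miss only the set with its own index.

For the step, let `g` be given on the `k`-skeleton of a much larger simplex. The obstruction to
filling a `(k + 1)`-simplex is the homology class of the image of its boundary: one of at most `2 ^
b` classes, once an intersection of the family is fixed. Where all these classes agree, the
boundaries of an even number of simplices have a sum that bounds. The barycentric subdivision of a
`(k + 1)`-simplex has `(k + 2)!` top simplices, an even number. So composing `g` with the
subdivision of a smaller simplex kills the obstruction, provided that the classes agree on the
subdivision of each face `σ` (`SkeletonMap.Homologous.exists_d_eq`, `SkeletonMap.nonempty_succ`).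

The class depends on the intersection, hence on the vertices allowed, so Ramsey's theorem is used
twice. Within each long sequence of vertices it yields `2 ^ (k + 2) - 1` of them with homologous
boundaries (`SkeletonMap.exists_homologous`); applied to the sequences themselves it makes the
positions of these vertices constant (`exists_strictMono_comp_eq`). The barycentres of the faces of
`σ` then go to these positions, and the gaps are filled with points private to `σ`, so that the
vertex sets attached to faces still intersect correctly (`FlagRoom.exists_strictMono`). -/

/-! ### Ramsey theory -/

/-- **Ramsey's theorem** for hypergraphs: an `r`-uniform hypergraph colouring on a sufficiently
large vertex set is constant on the `r`-subsets of some `m`-element set. -/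
theorem Finset.exists_monochromatic (κ : Type*) [Finite κ] [Nonempty κ] (r m : ℕ) :
    ∃ M : ℕ, ∀ {α : Type u} (A : Finset α), M ≤ A.card → ∀ col : Finset α → κ,
      ∃ L ⊆ A, L.card = m ∧ ∃ a, ∀ S ⊆ L, S.card = r → col S = a := by
  classical
  cases nonempty_fintype κ
  induction r generalizing m with
  | zero =>
    refine ⟨m, fun A hA col => ?_⟩
    obtain ⟨L, hL, hm⟩ := Finset.exists_subset_card_eq hA
    refine ⟨L, hL, hm, col ∅, fun S _ h => ?_⟩
    rw [Finset.card_eq_zero.mp h]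
  | succ r ih =>
    -- Choosing vertices one at a time makes the colour of an `(r + 1)`-set depend only on its
    -- earliest chosen element; the pigeonhole principle then makes it constant.
    have endHomogeneous (t : ℕ) : ∃ M : ℕ, ∀ {α : Type u} (A : Finset α), M ≤ A.card →
        ∀ col : Finset α → κ, ∃ B ⊆ A, B.card = t ∧ ∃ f : α → κ,
          ∀ S ⊆ B, S.card = r + 1 → ∃ x ∈ S, col S = f x := by
      induction t with
      | zero =>
        refine ⟨0, fun A _ col => ⟨∅, A.empty_subset, rfl, fun _ => Classical.arbitrary κ, ?_⟩⟩
        intro S hS h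
        simp [Finset.subset_empty.mp hS] at h
      | succ t iht =>
        obtain ⟨M₁, h₁⟩ := iht
        obtain ⟨M₂, h₂⟩ := ih M₁
        refine ⟨M₂ + 1, fun A hA col => ?_⟩
        obtain ⟨x, hx⟩ : A.Nonempty := Finset.card_pos.mp (by omega)
        obtain ⟨L, hL, hLc, a, ha⟩ := h₂ (A.erase x)
          (by rw [Finset.card_erase_of_mem hx]; omega) fun S => col (insert x S)
        obtain ⟨B, hB, hBc, f, hf⟩ := h₁ L hLc.ge col
        have hxB : x ∉ B := fun h => by simpa using hL (hB h)
        refine ⟨insert x B, ?_, by rw [Finset.card_insert_of_notMem hxB, hBc],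
          Function.update f x a, fun S hS hSc => ?_⟩
        · exact Finset.insert_subset hx
            ((hB.trans hL).trans (Finset.erase_subset x A))
        · by_cases hxS : x ∈ S
          · refine ⟨x, hxS, ?_⟩
            have hsub : S.erase x ⊆ L := (Finset.subset_insert_iff.mp hS).trans hB
            have := ha _ hsub (by rw [Finset.card_erase_of_mem hxS, hSc]; rfl)
            rw [Finset.insert_erase hxS] at this
            simp [this]
          · obtain ⟨y, hy, hcol⟩ := hf S ((Finset.subset_insert_iff_of_notMem hxS).mp hS) hSc
            refine ⟨y, hy, ?_⟩
            rw [hcol, Function.update_of_ne]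
            rintro rfl
            exact hxS hy
    obtain ⟨M, hM⟩ := endHomogeneous (Fintype.card κ * m)
    refine ⟨M, fun A hA col => ?_⟩
    obtain ⟨B, hB, hBc, f, hf⟩ := hM A hA col
    obtain ⟨a, -, ha⟩ := Finset.exists_le_card_fiber_of_mul_le_card_of_maps_to
      (s := B) (t := Finset.univ) (f := f) (n := m) (fun _ _ => Finset.mem_univ _)
      Finset.univ_nonempty (by rw [hBc, Finset.card_univ])
    obtain ⟨L, hL, hLc⟩ := Finset.exists_subset_card_eq ha
    refine ⟨L, hL.trans ((Finset.filter_subset _ _).trans hB), hLc, a, fun S hS hSc => ?_⟩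
    obtain ⟨x, hx, hcol⟩ := hf S (hS.trans (hL.trans (Finset.filter_subset _ _))) hSc
    rw [hcol]
    exact (Finset.mem_filter.mp (hL (hS hx))).2

/-- Ramsey's theorem for increasing sequences: a colouring of the sequences of length `r` in a
long enough chain is constant on the increasing sequences in some copy of `G`. -/
theorem exists_strictMono_comp_eq (κ : Type*) [Finite κ] [Nonempty κ] (r : ℕ)
    (G : Type*) [LinearOrder G] [Fintype G] :
    ∃ M : ℕ, ∀ P : (Fin r → Fin M) → κ, ∃ j : G → Fin M, StrictMono j ∧
      ∃ a, ∀ e : Fin r → G, StrictMono e → P (j ∘ e) = a := by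
  classical
  obtain ⟨M, hM⟩ := Finset.exists_monochromatic.{0} κ r (Fintype.card G)
  refine ⟨M, fun P => ?_⟩
  -- An `r`-set gets the colour of its increasing enumeration; the default on other sets is never
  -- used.
  obtain ⟨L, -, hLc, a, ha⟩ := hM (Finset.univ : Finset (Fin M)) (by simp) fun S =>
    if h : S.card = r then P (S.orderEmbOfFin h) else Classical.arbitrary κ
  let j : G → Fin M := L.orderEmbOfFin hLc ∘ (Fintype.orderIsoFinOfCardEq G rfl).symm
  have hj : StrictMono j :=
    (L.orderEmbOfFin hLc).strictMono.comp (OrderIso.strictMono _)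
  refine ⟨j, hj, a, fun e he => ?_⟩
  have hje := hj.comp he
  have hcard : (Finset.univ.image (j ∘ e)).card = r := by
    rw [Finset.card_image_of_injective _ hje.injective, Finset.card_univ, Fintype.card_fin]
  have := ha (Finset.univ.image (j ∘ e)) (fun x hx => by
    obtain ⟨y, -, rfl⟩ := Finset.mem_image.mp hx
    exact L.orderEmbOfFin_mem hLc _) hcard
  rw [dif_pos hcard] at this
  rw [← this]
  exact congrArg P (Finset.orderEmbOfFin_unique hcard
    (fun x => Finset.mem_image_of_mem _ (Finset.mem_univ x)) hje)

/-! ### Formal chains and barycentric subdivision -/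

noncomputable section

/-- The formal boundary of a finite set, over `ℤ/2`: the sum of the sets obtained by removing one
element. The empty set is a formal simplex of dimension `-1`. -/
def formalBoundary {β : Type*} [DecidableEq β] :
    (Finset β →₀ ZMod 2) →ₗ[ZMod 2] (Finset β →₀ ZMod 2) :=
  Finsupp.linearCombination (ZMod 2) fun τ => ∑ v ∈ τ, Finsupp.single (τ.erase v) 1

/-- The cone with apex `x` over a formal chain. -/
def formalCone {β : Type*} [DecidableEq β] (x : β) :
    (Finset β →₀ ZMod 2) →ₗ[ZMod 2] (Finset β →₀ ZMod 2) :=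
  Finsupp.linearCombination (ZMod 2) fun τ => Finsupp.single (insert x τ) 1

/-- A double sum over ordered pairs of distinct elements of a symmetric function vanishes in
characteristic two. -/
theorem Finset.sum_sum_erase_erase_eq_zero {α M : Type*} [DecidableEq α] [AddCommGroup M]
    [Module (ZMod 2) M] (σ : Finset α) (f : Finset α → M) :
    ∑ v ∈ σ, ∑ w ∈ σ.erase v, f ((σ.erase v).erase w) = 0 := by
  rw [Finset.sum_sigma' σ (fun v => σ.erase v) fun v w => f ((σ.erase v).erase w)]
  refine Finset.sum_involution (fun x _ => ⟨x.2, x.1⟩) ?_ ?_ ?_ ?_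
  · rintro ⟨v, w⟩ _
    dsimp only
    rw [Finset.erase_right_comm]
    exact ZModModule.add_self _
  · rintro ⟨v, w⟩ h _ heq
    simp only [Finset.mem_sigma, Finset.mem_erase] at h
    exact h.2.1 (congrArg Sigma.fst heq)
  · rintro ⟨v, w⟩ h
    simp only [Finset.mem_sigma, Finset.mem_erase] at h ⊢
    exact ⟨h.2.2, Ne.symm h.2.1, h.1⟩
  · rintro ⟨v, w⟩ _
    rfl

section FormalChains

variable {β : Type*}

/-- The formal chains on the sets that satisfy a predicate. -/
def formalChainsOn (p : Finset β → Prop) : Submodule (ZMod 2) (Finset β →₀ ZMod 2) :=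
  Submodule.span (ZMod 2) ((fun τ => Finsupp.single τ 1) '' {τ | p τ})

theorem single_mem_formalChainsOn {p : Finset β → Prop} {τ : Finset β} (h : p τ) :
    Finsupp.single τ (1 : ZMod 2) ∈ formalChainsOn p :=
  Submodule.subset_span ⟨τ, h, rfl⟩

theorem formalChainsOn_mono {p q : Finset β → Prop} (h : ∀ τ, p τ → q τ) :
    formalChainsOn p ≤ formalChainsOn q :=
  Submodule.span_mono (Set.image_mono h)

/-- Two linear maps that agree on the generators agree on the chains that they generate. -/
theorem eqOn_formalChainsOn {p : Finset β → Prop} {M : Type*} [AddCommGroup M] [Module (ZMod 2) M]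
    {f g : (Finset β →₀ ZMod 2) →ₗ[ZMod 2] M}
    (h : ∀ τ, p τ → f (Finsupp.single τ 1) = g (Finsupp.single τ 1))
    {c : Finset β →₀ ZMod 2} (hc : c ∈ formalChainsOn p) : f c = g c := by
  refine LinearMap.eqOn_span (s := (fun τ => Finsupp.single τ 1) '' {τ | p τ}) ?_ hc
  rintro _ ⟨τ, hτ, rfl⟩
  exact h τ hτ

/-- A linear map takes chains to a submodule if it takes the generators there. -/
theorem map_mem_of_mem_formalChainsOn {p : Finset β → Prop} {M : Type*} [AddCommGroup M]
    [Module (ZMod 2) M] {f : (Finset β →₀ ZMod 2) →ₗ[ZMod 2] M} {S : Submodule (ZMod 2) M}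
    (h : ∀ τ, p τ → f (Finsupp.single τ 1) ∈ S)
    {c : Finset β →₀ ZMod 2} (hc : c ∈ formalChainsOn p) : f c ∈ S := by
  have : formalChainsOn p ≤ S.comap f := by
    refine Submodule.span_le.mpr ?_
    rintro _ ⟨τ, hτ, rfl⟩
    exact h τ hτ
  exact this hc

/-- The sum of the coefficients of a formal chain. -/
def formalCount : (Finset β →₀ ZMod 2) →ₗ[ZMod 2] ZMod 2 :=
  Finsupp.linearCombination (ZMod 2) fun _ => 1

theorem formalCount_single (τ : Finset β) : formalCount (Finsupp.single τ 1) = 1 := by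
  simp [formalCount]

end FormalChains

section Subdivision

variable {α β : Type*} [DecidableEq α] [DecidableEq β]

@[simp]
theorem formalBoundary_single (τ : Finset β) :
    formalBoundary (Finsupp.single τ 1) = ∑ v ∈ τ, Finsupp.single (τ.erase v) (1 : ZMod 2) := by
  simp [formalBoundary]

@[simp]
theorem formalCone_single (x : β) (τ : Finset β) :
    formalCone x (Finsupp.single τ 1) = Finsupp.single (insert x τ) (1 : ZMod 2) := by
  simp [formalCone]

/-- Removing the apex gives back the base; removing another vertex gives the cone over a facet. If
`x` were in the base, the insertion would collapse. -/
theorem formalBoundary_formalCone {x : β} {c : Finset β →₀ ZMod 2}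
    (hc : c ∈ formalChainsOn fun τ => x ∉ τ) :
    formalBoundary (formalCone x c) = c + formalCone x (formalBoundary c) := by
  refine eqOn_formalChainsOn (f := formalBoundary ∘ₗ formalCone x)
    (g := LinearMap.id + formalCone x ∘ₗ formalBoundary) (fun τ hτ => ?_) hc
  simp only [LinearMap.comp_apply, formalCone_single, formalBoundary_single, LinearMap.add_apply,
    LinearMap.id_apply, map_sum]
  rw [Finset.sum_insert hτ, Finset.erase_insert hτ]
  congr 1
  refine Finset.sum_congr rfl fun v hv => ?_
  rw [Finset.erase_insert_of_ne]
  rintro rfl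
  exact hτ hv

/-- The formal barycentric subdivision of a simplex `σ`, the barycentre of a face `ρ` being
labelled by `ι ρ`: the sum of the complete flags of nonempty faces of `σ`. -/
def formalSubdivision (ι : Finset α → β) (σ : Finset α) : Finset β →₀ ZMod 2 :=
  if σ = ∅ then Finsupp.single ∅ 1
  else formalCone (ι σ) (∑ v : {v // v ∈ σ}, formalSubdivision ι (σ.erase v))
termination_by σ.card
decreasing_by exact Finset.card_erase_lt_of_mem v.2

theorem formalSubdivision_empty (ι : Finset α → β) :
    formalSubdivision ι ∅ = Finsupp.single ∅ 1 := by
  rw [formalSubdivision, if_pos rfl]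

theorem formalSubdivision_of_nonempty (ι : Finset α → β) {σ : Finset α} (hσ : σ.Nonempty) :
    formalSubdivision ι σ =
      formalCone (ι σ) (∑ v ∈ σ, formalSubdivision ι (σ.erase v)) := by
  rw [formalSubdivision, if_neg hσ.ne_empty,
    Finset.sum_coe_sort σ fun v => formalSubdivision ι (σ.erase v)]

theorem formalSubdivision_singleton (ι : Finset α → β) (v : α) :
    formalSubdivision ι {v} = Finsupp.single {ι {v}} 1 := by
  rw [formalSubdivision_of_nonempty ι (Finset.singleton_nonempty v)]
  simp [formalSubdivision_empty]

/-- Injectivity of `ι` keeps the apex apart from the labels of proper faces, so each cone raises the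
cardinality by one. -/
theorem formalSubdivision_mem {ι : Finset α → β} (hι : Function.Injective ι) (σ : Finset α) :
    formalSubdivision ι σ ∈ formalChainsOn fun τ =>
      τ.card = σ.card ∧ ∀ x ∈ τ, ∃ ρ ⊆ σ, ρ.Nonempty ∧ ι ρ = x := by
  induction σ using Finset.strongInduction with
  | H σ ih =>
    rcases σ.eq_empty_or_nonempty with rfl | hσ
    · rw [formalSubdivision_empty]
      exact single_mem_formalChainsOn (by simp)
    · rw [formalSubdivision_of_nonempty ι hσ, map_sum]
      refine Submodule.sum_mem _ fun v hv => ?_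
      refine map_mem_of_mem_formalChainsOn (fun τ hτ => ?_) (ih _ (Finset.erase_ssubset hv))
      rw [formalCone_single]
      have hmem : ι σ ∉ τ := by
        intro h
        obtain ⟨ρ, hρ, -, hρσ⟩ := hτ.2 _ h
        rw [hι hρσ] at hρ
        exact Finset.notMem_erase v σ (hρ hv)
      refine single_mem_formalChainsOn ⟨?_, ?_⟩
      · rw [Finset.card_insert_of_notMem hmem, hτ.1, Finset.card_erase_add_one hv]
      · intro x hx
        rcases Finset.mem_insert.mp hx with rfl | hx
        · exact ⟨σ, subset_rfl, hσ, rfl⟩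
        · obtain ⟨ρ, hρ, hne, rfl⟩ := hτ.2 x hx
          exact ⟨ρ, hρ.trans (Finset.erase_subset _ _), hne, rfl⟩

theorem sum_formalSubdivision_erase_mem {ι : Finset α → β} (hι : Function.Injective ι)
    (σ : Finset α) :
    ∑ v ∈ σ, formalSubdivision ι (σ.erase v) ∈ formalChainsOn fun τ => ι σ ∉ τ := by
  refine Submodule.sum_mem _ fun v hv => ?_
  refine formalChainsOn_mono (fun τ hτ h => ?_) (formalSubdivision_mem hι (σ.erase v))
  obtain ⟨ρ, hρ, -, hρσ⟩ := hτ.2 _ h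
  rw [hι hρσ] at hρ
  exact Finset.notMem_erase v σ (hρ hv)

/-- Subdivision is a chain map. -/
theorem formalBoundary_formalSubdivision {ι : Finset α → β} (hι : Function.Injective ι)
    (σ : Finset α) :
    formalBoundary (formalSubdivision ι σ) = ∑ v ∈ σ, formalSubdivision ι (σ.erase v) := by
  induction σ using Finset.strongInduction with
  | H σ ih =>
    rcases σ.eq_empty_or_nonempty with rfl | hσ
    · simp [formalSubdivision_empty]
    · rw [formalSubdivision_of_nonempty ι hσ,
        formalBoundary_formalCone (sum_formalSubdivision_erase_mem hι σ), map_sum,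
        Finset.sum_congr rfl fun v hv => ih _ (Finset.erase_ssubset hv),
        Finset.sum_sum_erase_erase_eq_zero, map_zero, add_zero]

theorem formalCount_formalCone (x : β) (c : Finset β →₀ ZMod 2) :
    formalCount (formalCone x c) = formalCount c := by
  have : formalCount ∘ₗ formalCone x = (formalCount : (Finset β →₀ ZMod 2) →ₗ[ZMod 2] ZMod 2) := by
    ext τ
    simp [formalCount_single]
  exact LinearMap.congr_fun this c

/-- Coning preserves the count and `σ` has `σ.card` facets, whence the factorial recursion. -/
theorem formalCount_formalSubdivision (ι : Finset α → β) (σ : Finset α) :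
    formalCount (formalSubdivision ι σ) = (σ.card.factorial : ZMod 2) := by
  induction σ using Finset.strongInduction with
  | H σ ih =>
    rcases σ.eq_empty_or_nonempty with rfl | hσ
    · simp [formalSubdivision_empty, formalCount_single]
    · rw [formalSubdivision_of_nonempty ι hσ, formalCount_formalCone, map_sum,
        Finset.sum_congr rfl fun v hv => ih _ (Finset.erase_ssubset hv),
        Finset.sum_congr rfl fun v hv => by rw [Finset.card_erase_of_mem hv], Finset.sum_const,
        nsmul_eq_mul, ← Nat.cast_mul, Nat.mul_factorial_pred hσ.card_ne_zero]

theorem formalCount_formalSubdivision_eq_zero (ι : Finset α → β) {σ : Finset α}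
    (hσ : 2 ≤ σ.card) : formalCount (formalSubdivision ι σ) = 0 := by
  rw [formalCount_formalSubdivision, ZMod.natCast_eq_zero_iff]
  exact Nat.dvd_factorial two_pos hσ

end Subdivision

/-! ### Singular chains and their supports -/

namespace SingularMod2

open CategoryTheory

variable {X : Type u} [TopologicalSpace X]

/-- The generator of the singular chain group attached to a singular simplex. -/
def generator {n : ℕ} (s : Simplex X n) : (complex X).X n :=
  ((TopCat.toSSet.obj (TopCat.of X)).ιChainComplex (R := coefficients)
    (((TopCat.of X).toSSetObjEquiv _).symm s)).hom ⟨1⟩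

theorem coeff_ι {n : ℕ} (x) (r : coefficients) :
    coeff n (((TopCat.toSSet.obj (TopCat.of X)).ιChainComplex (R := coefficients) (n := n) x).hom r)
      = Finsupp.single ((TopCat.of X).toSSetObjEquiv _ x) r.down := by
  have := ((TopCat.toSSet.obj (TopCat.of X)).isColimitChainComplexXCofan
    coefficients n).fac
      (CategoryTheory.Limits.Cofan.mk (ModuleCat.of (ZMod 2) (Simplex X n →₀ ZMod 2)) fun s =>
        ModuleCat.ofHom
          ((Finsupp.lsingle ((TopCat.of X).toSSetObjEquiv _ s)).comp
            (ULift.moduleEquiv : ULift.{u} (ZMod 2) ≃ₗ[ZMod 2] ZMod 2).toLinearMap)) ⟨x⟩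
  exact LinearMap.congr_fun (congrArg ModuleCat.Hom.hom this) r

theorem coeff_generator {n : ℕ} (s : Simplex X n) :
    coeff n (generator s) = Finsupp.single s 1 := by
  rw [generator, coeff_ι, Equiv.apply_symm_apply]

/-- Linear maps on singular chains are determined by their values on generators. -/
theorem hom_ext {n : ℕ} {M : Type u} [AddCommGroup M] [Module (ZMod 2) M]
    {f g : (complex X).X n →ₗ[ZMod 2] M} (h : ∀ s, f (generator s) = g (generator s)) : f = g := by
  have : ModuleCat.ofHom f = ModuleCat.ofHom g := by
    refine SSet.chainComplex_hom_ext (X := TopCat.toSSet.obj (TopCat.of X)) (R := coefficients)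
      fun x => ?_
    ext r
    have hr : r = r.down • (⟨1⟩ : coefficients) := by
      ext
      simp
    have hx := h ((TopCat.of X).toSSetObjEquiv _ x)
    rw [generator, Equiv.symm_apply_apply] at hx
    rw [hr, map_smul, map_smul]
    exact congrArg (r.down • ·) hx
  exact congrArg ModuleCat.Hom.hom this

/-- Singular chains are finitely supported functions on singular simplices. -/
def coeffEquiv (n : ℕ) : (complex X).X n ≃ₗ[ZMod 2] (Simplex X n →₀ ZMod 2) :=
  LinearEquiv.ofLinearMap (coeff n) (Finsupp.linearCombination (ZMod 2) generator)
    (by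
      ext s : 2
      simp [coeff_generator])
    (by
      refine hom_ext fun s => ?_
      simp [coeff_generator])

@[simp]
theorem coeffEquiv_apply {n : ℕ} (c : (complex X).X n) : coeffEquiv n c = coeff n c := rfl

theorem coeff_injective (n : ℕ) : Function.Injective (coeff (X := X) n) :=
  (coeffEquiv n).injective

/-- The map of singular chain complexes induced by a continuous map. -/
def complexMap {Y : Type u} [TopologicalSpace Y] (f : C(X, Y)) : complex X ⟶ complex Y :=
  ((AlgebraicTopology.singularChainComplexFunctor (ModuleCat.{u} (ZMod 2))).obj
    coefficients).map (TopCat.ofHom f)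

theorem complexMap_generator {Y : Type u} [TopologicalSpace Y] (f : C(X, Y)) {n : ℕ}
    (s : Simplex X n) : (complexMap f).f n (generator s) = generator (f.comp s) := by
  have := SSet.ι_chainComplexMap_f (TopCat.toSSet.obj (TopCat.of X))
    (TopCat.toSSet.obj (TopCat.of Y)) (TopCat.toSSet.map (TopCat.ofHom f)) coefficients
    (((TopCat.of X).toSSetObjEquiv _).symm s)
  exact LinearMap.congr_fun (congrArg ModuleCat.Hom.hom this) ⟨1⟩

theorem coeff_complexMap {Y : Type u} [TopologicalSpace Y] (f : C(X, Y)) {n : ℕ}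
    (c : (complex X).X n) :
    coeff n ((complexMap f).f n c) = Finsupp.mapDomain f.comp (coeff n c) := by
  have : coeff n ∘ₗ ((complexMap f).f n).hom =
      Finsupp.lmapDomain (ZMod 2) (ZMod 2) f.comp ∘ₗ coeff n := by
    refine hom_ext fun s => ?_
    simp [complexMap_generator, coeff_generator, Finsupp.mapDomain_single]
  exact LinearMap.congr_fun this c

theorem complexMap_d {Y : Type u} [TopologicalSpace Y] (f : C(X, Y)) (i j : ℕ)
    (c : (complex X).X i) :
    (complex Y).d i j ((complexMap f).f i c) = (complexMap f).f j ((complex X).d i j c) :=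
  LinearMap.congr_fun (congrArg ModuleCat.Hom.hom ((complexMap f).comm i j)) c

/-- The chains supported in a set `A`. -/
def supportedIn (A : Set X) (n : ℕ) : Submodule (ZMod 2) ((complex X).X n) :=
  (Finsupp.supported (ZMod 2) (ZMod 2) {s : Simplex X n | Set.range s ⊆ A}).comap (coeff n)

theorem mem_supportedIn {A : Set X} {n : ℕ} {c : (complex X).X n} :
    c ∈ supportedIn A n ↔ support c ⊆ A := by
  simp only [supportedIn, Submodule.mem_comap, Finsupp.mem_supported, support,
    Set.iUnion_subset_iff]
  rfl

theorem supportedIn_mono {A B : Set X} (h : A ⊆ B) (n : ℕ) : supportedIn A n ≤ supportedIn B n :=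
  fun _ hc => mem_supportedIn.mpr ((mem_supportedIn.mp hc).trans h)

/-- The inclusion of a subspace. -/
abbrev inclusion (A : Set X) : C(A, X) := ⟨Subtype.val, continuous_subtype_val⟩

theorem inclusion_comp_injective (A : Set X) (n : ℕ) :
    Function.Injective ((inclusion A).comp : Simplex A n → Simplex X n) := by
  intro s t h
  ext x
  exact DFunLike.congr_fun h x

theorem complexMap_inclusion_injective (A : Set X) (n : ℕ) :
    Function.Injective ((complexMap (inclusion A)).f n) := by
  intro c c' h
  apply coeff_injective
  apply Finsupp.mapDomain_injective (inclusion_comp_injective A n)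
  rw [← coeff_complexMap, ← coeff_complexMap]
  exact congrArg _ h

theorem complexMap_inclusion_mem (A : Set X) {n : ℕ} (c : (complex A).X n) :
    (complexMap (inclusion A)).f n c ∈ supportedIn A n := by
  classical
  rw [supportedIn, Submodule.mem_comap, coeff_complexMap, Finsupp.mem_supported]
  intro s hs
  obtain ⟨t, -, rfl⟩ := Finset.mem_image.mp (Finsupp.mapDomain_support hs)
  rintro _ ⟨x, rfl⟩
  exact (t x).2

/-- With injectivity of the induced map, this identifies chains of `X` supported in `A` with chains
of the subspace `A`, where the Betti number bound applies. -/
theorem exists_complexMap_inclusion_eq {A : Set X} {n : ℕ} {c : (complex X).X n}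
    (hc : c ∈ supportedIn A n) : ∃ c', (complexMap (inclusion A)).f n c' = c := by
  rw [supportedIn, Submodule.mem_comap, Finsupp.mem_supported] at hc
  have hinj := inclusion_comp_injective A n
  refine ⟨(coeffEquiv n).symm (Finsupp.comapDomain (inclusion A).comp (coeff n c) hinj.injOn), ?_⟩
  apply coeff_injective
  rw [coeff_complexMap, ← coeffEquiv_apply, LinearEquiv.apply_symm_apply,
    Finsupp.mapDomain_comapDomain _ hinj]
  intro s hs
  exact ⟨⟨fun x => ⟨s x, hc hs ⟨x, rfl⟩⟩, s.continuous.subtype_mk _⟩, rfl⟩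

end SingularMod2

/-! ### Colouring cycles by homology class -/

/-- A vector space of dimension at most `b` has an injective linear map to `Fin b → F`. -/
theorem exists_injective_of_rank_le {F M : Type*} [Field F] [AddCommGroup M] [Module F M] {b : ℕ}
    (h : Module.rank F M ≤ b) : ∃ f : M →ₗ[F] (Fin b → F), Function.Injective f := by
  have : Module.Finite F M :=
    Module.rank_lt_aleph0_iff.mp (h.trans_lt Cardinal.natCast_lt_aleph0)
  have hb : Module.finrank F M ≤ b := by
    rw [← Module.finrank_eq_rank] at h
    exact_mod_cast h
  refine ⟨(Finsupp.linearEquivFunOnFinite F F (Fin b)).toLinearMap ∘ₗ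
    Finsupp.lmapDomain F F (Fin.castLE hb) ∘ₗ (Module.finBasis F M).repr.toLinearMap, ?_⟩
  exact (Finsupp.linearEquivFunOnFinite F F (Fin b)).injective.comp
    ((Finsupp.mapDomain_injective (Fin.castLE_injective hb)).comp
      (Module.finBasis F M).repr.injective)

namespace SingularMod2

open CategoryTheory

/-- If the `k`-th Betti number is at most `b`, then the `k`-cycles can be coloured with `2 ^ b`
colours so that cycles of the same colour are homologous. -/
theorem exists_coloring_of_betti_le_univ (X : Type u) [TopologicalSpace X] (k b : ℕ)
    (h : betti k X ≤ b) :
    ∃ col : (complex X).X k → (Fin b → ZMod 2), ∀ z z' : (complex X).X k,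
      (∀ j, (complex X).d k j z = 0) → (∀ j, (complex X).d k j z' = 0) → col z = col z' →
        ∃ w : (complex X).X (k + 1), (complex X).d (k + 1) k w = z + z' := by
  classical
  obtain ⟨φ, hφ⟩ := exists_injective_of_rank_le h
  let S := (complex X).sc k
  let e := S.moduleCatHomologyIso
  let q : LinearMap.ker S.g.hom → (Fin b → ZMod 2) := fun z =>
    φ (e.inv (Submodule.Quotient.mk z))
  -- The colour is the coordinate vector of the homology class; the value at non-cycles is never
  -- compared.
  let col (z : (complex X).X k) : Fin b → ZMod 2 := if hz : S.g.hom z = 0 then q ⟨z, hz⟩ else 0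
  have hcol_eq (z : (complex X).X k) (hz : S.g.hom z = 0) : col z = q ⟨z, hz⟩ := dif_pos hz
  refine ⟨col, fun z z' hz hz' hcol => ?_⟩
  rw [hcol_eq z (hz _), hcol_eq z' (hz' _)] at hcol
  have heq := (ConcreteCategory.injective_of_mono_of_preservesPullback e.inv) (hφ hcol)
  obtain ⟨w, hw⟩ := (Submodule.Quotient.eq _).mp heq
  have hdw : (complex X).d ((ComplexShape.down ℕ).prev k) k w = z - z' :=
    congrArg Subtype.val hw
  -- The predecessor of `k` in the complex shape is `k + 1` only propositionally.
  have transport : ∀ i, i = k + 1 → (∃ w : (complex X).X i, (complex X).d i k w = z - z') →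
      ∃ w : (complex X).X (k + 1), (complex X).d (k + 1) k w = z + z' := by
    rintro _ rfl ⟨w, hw⟩
    exact ⟨w, by rw [hw, ZModModule.sub_eq_add]⟩
  exact transport _ (ChainComplex.prev ℕ k) ⟨w, hdw⟩

/-- If a subspace has `k`-th Betti number at most `b`, then the `k`-cycles supported in it can be
coloured with `2 ^ b` colours so that cycles of the same colour are homologous in the subspace. -/
theorem exists_coloring_of_betti_le {X : Type u} [TopologicalSpace X] (A : Set X) (k b : ℕ)
    (h : betti k A ≤ b) :
    ∃ col : (complex X).X k → (Fin b → ZMod 2),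
      ∀ z ∈ supportedIn A k, ∀ z' ∈ supportedIn A k,
        (∀ j, (complex X).d k j z = 0) → (∀ j, (complex X).d k j z' = 0) → col z = col z' →
          ∃ w ∈ supportedIn A (k + 1), (complex X).d (k + 1) k w = z + z' := by
  classical
  obtain ⟨col, hcol⟩ := exists_coloring_of_betti_le_univ A k b h
  have hinj := complexMap_inclusion_injective A k
  -- A chain supported in `A` takes the colour of its unique preimage in `A`.
  refine ⟨fun z => col (Function.invFun ((complexMap (inclusion A)).f k) z), ?_⟩
  intro z hz z' hz' hdz hdz' heq
  obtain ⟨c, rfl⟩ := exists_complexMap_inclusion_eq hz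
  obtain ⟨c', rfl⟩ := exists_complexMap_inclusion_eq hz'
  dsimp only at heq
  rw [Function.leftInverse_invFun hinj c, Function.leftInverse_invFun hinj c'] at heq
  have lift (c : (complex A).X k)
      (hc : ∀ j, (complex X).d k j ((complexMap (inclusion A)).f k c) = 0) (j : ℕ) :
      (complex A).d k j c = 0 := by
    apply complexMap_inclusion_injective A j
    rw [← complexMap_d, hc, map_zero]
  obtain ⟨w, hw⟩ := hcol c c' (lift c hdz) (lift c' hdz') heq
  refine ⟨_, complexMap_inclusion_mem A w, ?_⟩
  rw [complexMap_d, hw, map_add]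

/-- The sum of the coefficients of a singular `0`-chain. -/
def augmentation (X : Type u) [TopologicalSpace X] : (complex X).X 0 →ₗ[ZMod 2] ZMod 2 :=
  Finsupp.linearCombination (ZMod 2) (fun _ => 1) ∘ₗ coeff 0

/-- A nonzero coefficient in `ℤ/2` is `1`, so the augmentation is the parity of the support: it
expresses nontriviality linearly. -/
theorem odd_card_support {X : Type u} [TopologicalSpace X] {c : (complex X).X 0}
    (hc : augmentation X c = 1) : Odd (coeff 0 c).support.card := by
  rw [← ZMod.natCast_eq_one_iff_odd, ← hc, augmentation, LinearMap.comp_apply,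
    Finsupp.linearCombination_apply, Finsupp.sum, Finset.card_eq_sum_ones, Nat.cast_sum]
  refine Finset.sum_congr rfl fun s hs => ?_
  rw [Finsupp.mem_support_iff] at hs
  generalize coeff 0 c s = r at hs
  revert r
  decide

theorem exists_mem_supportedIn_augmentation_eq_one {X : Type u} [TopologicalSpace X] {A : Set X}
    (hA : A.Nonempty) : ∃ c ∈ supportedIn A 0, augmentation X c = 1 := by
  obtain ⟨x, hx⟩ := hA
  refine ⟨generator (ContinuousMap.const _ x), ?_, ?_⟩
  · rw [supportedIn, Submodule.mem_comap, coeff_generator]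
    refine Finsupp.single_mem_supported _ _ ?_
    rintro _ ⟨y, rfl⟩
    exact hx
  · simp [augmentation, coeff_generator]

end SingularMod2

/-! ### Placing barycentres at prescribed positions -/

section Placement

/-- Room for the barycentres of the faces of a simplex with vertex set `Fin N`, and for
additional points between them: the barycentre of `ρ` is at `(ρ, 0, ρ)`, and the additional points
used for a face `σ` have last component `σ`. -/
abbrev FlagRoom (N W : ℕ) : Type :=
  Colex (Finset (Fin N)) ×ₗ (Fin (W + 1) ×ₗ Colex (Finset (Fin N)))

instance (N W : ℕ) : Fintype (FlagRoom N W) :=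
  Fintype.ofEquiv (Finset (Fin N) × (Fin (W + 1) × Finset (Fin N)))
    ((toColex.prodCongr (((Equiv.refl _).prodCongr toColex).trans toLex)).trans toLex)

/-- The face to which a point belongs. -/
def FlagRoom.face {N W : ℕ} (y : FlagRoom N W) : Finset (Fin N) :=
  ofColex (ofLex (ofLex y).2).2

/-- The barycentre of a face. -/
def FlagRoom.barycentre {N W : ℕ} (ρ : Finset (Fin N)) : FlagRoom N W :=
  toLex (toColex ρ, toLex (0, toColex ρ))

@[simp]
theorem FlagRoom.face_barycentre {N W : ℕ} (ρ : Finset (Fin N)) :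
    (FlagRoom.barycentre ρ : FlagRoom N W).face = ρ := rfl

theorem FlagRoom.barycentre_injective {N W : ℕ} :
    Function.Injective (FlagRoom.barycentre : Finset (Fin N) → FlagRoom N W) :=
  Function.LeftInverse.injective FlagRoom.face_barycentre

/-- For a set `p` of positions with as many elements as `σ` has nonempty faces, there is an
increasing sequence of points that belong to faces of `σ`, with the barycentres of the nonempty
faces of `σ` exactly in the positions `p`. -/
theorem FlagRoom.exists_strictMono {N W : ℕ} (σ : Finset (Fin N)) (p : Finset (Fin W))
    (hσ : σ.Nonempty) (hp : p.card = 2 ^ σ.card - 1) :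
    ∃ e : Fin W → FlagRoom N W, StrictMono e ∧ (∀ x, (e x).face ⊆ σ ∧ (e x).face.Nonempty) ∧
      ∀ ρ ⊆ σ, ρ.Nonempty → ∃ x ∈ p, e x = barycentre ρ := by
  classical
  let R := Colex (Finset (Fin N))
  let T : Finset R := (σ.powerset.erase ∅).image toColex
  have hT : T.card = p.card := by
    rw [Finset.card_image_of_injective _ toColex.injective,
      Finset.card_erase_of_mem (Finset.empty_mem_powerset σ), Finset.card_powerset, hp]
  let θ : p ≃o T := (p.orderIsoOfFin rfl).symm.trans (T.orderIsoOfFin hT)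
  have hθ (y : p) : ofColex (θ y : R) ⊆ σ ∧ (ofColex (θ y : R)).Nonempty := by
    obtain ⟨ρ, hρ, hy⟩ := Finset.mem_image.mp (θ y).2
    rw [← hy]
    simp only [Finset.mem_erase, Finset.mem_powerset] at hρ
    exact ⟨hρ.2, Finset.nonempty_iff_ne_empty.mpr hρ.1⟩
  have hθbot (y : p) : (⊥ : R) < θ y := by
    rw [bot_lt_iff_ne_bot]
    intro h
    exact (hθ y).2.ne_empty (congrArg ofColex h)
  -- The last face whose barycentre is at or before position `x`; before the first barycentre it is
  -- `∅`, the bottom of the colex order.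
  let block (x : Fin W) : R := (Finset.univ.filter fun y : p => (y : Fin W) ≤ x).sup fun y => θ y
  have block_mono : Monotone block := fun x y hxy =>
    Finset.sup_mono (Finset.monotone_filter_right _ fun z _ hz => hz.trans hxy)
  have block_eq (x : Fin W) (hx : x ∈ p) : block x = θ ⟨x, hx⟩ := by
    apply le_antisymm
    · refine Finset.sup_le fun y hy => ?_
      exact θ.monotone (a := y) (b := ⟨x, hx⟩) (Finset.mem_filter.mp hy).2
    · exact Finset.le_sup (f := fun y : p => (θ y : R)) (b := ⟨x, hx⟩) (by simp)
  have block_lt (x y : Fin W) (hxy : x < y) (hy : y ∈ p) : block x < block y := by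
    rw [block_eq y hy]
    refine (Finset.sup_lt_iff (hθbot _)).mpr fun z hz => ?_
    exact θ.strictMono (a := z) (b := ⟨y, hy⟩) ((Finset.mem_filter.mp hz).2.trans_lt hxy)
  -- An extra point follows the barycentre of its block because `x.succ` is positive. Its last
  -- component makes it belong to `σ`, whichever block it lies in.
  let e (x : Fin W) : FlagRoom N W :=
    if x ∈ p then barycentre (ofColex (block x))
    else toLex (block x, toLex (x.succ, toColex σ))
  have e_of_mem (x : Fin W) (hx : x ∈ p) : e x = barycentre (ofColex (θ ⟨x, hx⟩ : R)) := by
    rw [← block_eq x hx]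
    exact if_pos hx
  have e_of_notMem (x : Fin W) (hx : x ∉ p) :
      e x = toLex (block x, toLex (x.succ, toColex σ)) := if_neg hx
  have e_fst (x : Fin W) : (ofLex (e x)).1 = block x := by
    by_cases hx : x ∈ p
    · rw [e_of_mem x hx, block_eq x hx]
      rfl
    · rw [e_of_notMem x hx]
      rfl
  refine ⟨e, fun x y hxy => ?_, fun x => ?_, fun ρ hρ hne => ?_⟩
  · rw [Prod.Lex.lt_iff, e_fst, e_fst]
    by_cases hy : y ∈ p
    · exact Or.inl (block_lt x y hxy hy)
    rcases (block_mono hxy.le).lt_or_eq with h | h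
    · exact Or.inl h
    refine Or.inr ⟨h, ?_⟩
    rw [e_of_notMem y hy, Prod.Lex.lt_iff]
    refine Or.inl ?_
    by_cases hx : x ∈ p
    · rw [e_of_mem x hx]
      exact Fin.succ_pos y
    · rw [e_of_notMem x hx]
      exact Fin.succ_lt_succ_iff.mpr hxy
  · by_cases hx : x ∈ p
    · rw [e_of_mem x hx]
      exact hθ _
    · rw [e_of_notMem x hx]
      exact ⟨subset_rfl, hσ⟩
  · have hmem : toColex ρ ∈ T :=
      Finset.mem_image_of_mem _ (Finset.mem_erase.mpr ⟨hne.ne_empty, Finset.mem_powerset.mpr hρ⟩)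
    refine ⟨_, (θ.symm ⟨toColex ρ, hmem⟩).2, ?_⟩
    rw [e_of_mem _ (θ.symm ⟨toColex ρ, hmem⟩).2, Subtype.coe_eta, OrderIso.apply_symm_apply]
    rfl

end Placement

/-! ### Chain maps on skeleta and their extension -/

/-- A map on the `k`-skeleton of the simplex with vertex set `α` to the chains of a complex `C`
with differential `d`, augmentation `ε` and filtration `S` by subsets of `ι`: a chain map over
`ℤ/2`, that maps vertices to chains of augmentation `1`, together with a map `Φ` that commutes with
intersections and controls the filtration. The values `toFun m τ` matter only for sets `τ` with
`m + 1` elements, where `m ≤ k`. -/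
structure SkeletonMap {C : ℕ → Type u} [∀ k, AddCommGroup (C k)] [∀ k, Module (ZMod 2) (C k)]
    (d : ∀ i j, C i →ₗ[ZMod 2] C j) (ε : C 0 →ₗ[ZMod 2] ZMod 2) {ι : Type} [DecidableEq ι]
    (S : Finset ι → ∀ k, Submodule (ZMod 2) (C k)) (k : ℕ) (α : Type) [DecidableEq α] where
  /-- The image of a simplex. -/
  toFun (m : ℕ) : Finset α → C m
  /-- The indices of the sets that the image of a simplex may leave. -/
  Φ : Finset α → Finset ι
  Φ_empty : Φ ∅ = ∅
  Φ_inter (σ τ : Finset α) : Φ (σ ∩ τ) = Φ σ ∩ Φ τ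
  Φ_nonempty (v : α) : (Φ {v}).Nonempty
  d_toFun (m : ℕ) (τ : Finset α) : τ.card = m + 2 → m + 1 ≤ k →
    d (m + 1) m (toFun (m + 1) τ) = ∑ v ∈ τ, toFun m (τ.erase v)
  toFun_mem (m : ℕ) (τ : Finset α) : τ.card = m + 1 → m ≤ k → toFun m τ ∈ S (Φ τ) m
  augmentation_toFun (v : α) : ε (toFun 0 {v}) = 1

namespace SkeletonMap

variable {C : ℕ → Type u} [∀ k, AddCommGroup (C k)] [∀ k, Module (ZMod 2) (C k)]
  {d : ∀ i j, C i →ₗ[ZMod 2] C j} {ε : C 0 →ₗ[ZMod 2] ZMod 2} {ι : Type} [DecidableEq ι]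
  {S : Finset ι → ∀ k, Submodule (ZMod 2) (C k)} {k : ℕ} {α : Type} [DecidableEq α]

theorem Φ_mono (g : SkeletonMap d ε S k α) {σ τ : Finset α} (h : σ ⊆ τ) : g.Φ σ ⊆ g.Φ τ := by
  rw [← Finset.inter_eq_left.mpr h, g.Φ_inter]
  exact Finset.inter_subset_right

/-- The extension to formal chains. -/
def lin (g : SkeletonMap d ε S k α) (m : ℕ) : (Finset α →₀ ZMod 2) →ₗ[ZMod 2] C m :=
  Finsupp.linearCombination (ZMod 2) (g.toFun m)

@[simp]
theorem lin_single (g : SkeletonMap d ε S k α) (m : ℕ) (τ : Finset α) :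
    g.lin m (Finsupp.single τ 1) = g.toFun m τ := by
  simp [lin]

theorem lin_formalBoundary_single (g : SkeletonMap d ε S k α) (m : ℕ) (τ : Finset α) :
    g.lin m (formalBoundary (Finsupp.single τ 1)) = ∑ v ∈ τ, g.toFun m (τ.erase v) := by
  simp

theorem d_lin (g : SkeletonMap d ε S k α) {m : ℕ} (hm : m + 1 ≤ k) {c : Finset α →₀ ZMod 2}
    (hc : c ∈ formalChainsOn fun τ => τ.card = m + 2) :
    d (m + 1) m (g.lin (m + 1) c) = g.lin m (formalBoundary c) := by
  refine eqOn_formalChainsOn (f := d (m + 1) m ∘ₗ g.lin (m + 1))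
    (g := g.lin m ∘ₗ formalBoundary) (fun τ hτ => ?_) hc
  rw [LinearMap.comp_apply, LinearMap.comp_apply, lin_formalBoundary_single, lin_single,
    g.d_toFun m τ hτ hm]

/-- The image of the boundary of a simplex is a cycle. -/
theorem d_sum_erase (g : SkeletonMap d ε S k α) (hd : ∀ i j, i ≠ j + 1 → d i j = 0)
    {τ : Finset α} (hτ : τ.card = k + 2) (j : ℕ) :
    d k j (∑ v ∈ τ, g.toFun k (τ.erase v)) = 0 := by
  by_cases hj : k = j + 1
  · subst hj
    rw [map_sum, Finset.sum_congr rfl fun v hv => g.d_toFun j (τ.erase v)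
      (by rw [Finset.card_erase_of_mem hv, hτ]; rfl) le_rfl]
    exact Finset.sum_sum_erase_erase_eq_zero τ (g.toFun j)
  · rw [hd k j hj, LinearMap.zero_apply]

theorem sum_erase_mem (g : SkeletonMap d ε S k α) (hS : Monotone S)
    {τ A : Finset α} (hτ : τ.card = k + 2) (hA : τ ⊆ A) :
    ∑ v ∈ τ, g.toFun k (τ.erase v) ∈ S (g.Φ A) k :=
  Submodule.sum_mem _ fun v hv =>
    hS (g.Φ_mono ((Finset.erase_subset v τ).trans hA)) k
      (g.toFun_mem k _ (by rw [Finset.card_erase_of_mem hv, hτ]; rfl) le_rfl)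

end SkeletonMap

/-- The base case: maps on a set of vertices. -/
theorem nonempty_skeletonMap_zero {C : ℕ → Type u} [∀ k, AddCommGroup (C k)]
    [∀ k, Module (ZMod 2) (C k)] (d : ∀ i j, C i →ₗ[ZMod 2] C j) (ε : C 0 →ₗ[ZMod 2] ZMod 2)
    {N n : ℕ} (hn : N ≤ n) (S : Finset (Fin n) → ∀ k, Submodule (ZMod 2) (C k))
    (hpt : ∀ I : Finset (Fin n), I.Nonempty → ∃ c ∈ S I 0, ε c = 1) :
    Nonempty (SkeletonMap d ε S 0 (Fin N)) := by
  classical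
  choose! c hc hε using hpt
  -- Vertices serve as indices of distinct sets of the family.
  let Φ (τ : Finset (Fin N)) : Finset (Fin n) := τ.map (Fin.castLEEmb hn)
  have hΦ (τ : Finset (Fin N)) (h : τ.Nonempty) : (Φ τ).Nonempty := h.map
  exact ⟨{
    toFun := fun m τ => match m with
      | 0 => c (Φ τ)
      | _ + 1 => 0
    Φ := Φ
    Φ_empty := Finset.map_empty _
    Φ_inter := fun σ τ => Finset.map_inter _ _
    Φ_nonempty := fun v => hΦ _ (Finset.singleton_nonempty v)
    d_toFun := fun m τ _ hm => absurd hm (by omega)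
    toFun_mem := fun m τ hτ hm => by
      obtain rfl : m = 0 := by omega
      exact hc _ (hΦ τ (Finset.card_pos.mp (by omega)))
    augmentation_toFun := fun v => hε _ (hΦ _ (Finset.singleton_nonempty v)) }⟩

namespace SkeletonMap

variable {C : ℕ → Type u} [∀ k, AddCommGroup (C k)] [∀ k, Module (ZMod 2) (C k)]
  {d : ∀ i j, C i →ₗ[ZMod 2] C j} {ε : C 0 →ₗ[ZMod 2] ZMod 2} {ι : Type} [DecidableEq ι]
  {S : Finset ι → ∀ k, Submodule (ZMod 2) (C k)} {k : ℕ} {α : Type} [DecidableEq α]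

/-- The `(k + 1)`-simplices in `T` have boundaries whose images are homologous in the part of the
filtration given by `A`. -/
def Homologous (g : SkeletonMap d ε S k α) (T A : Finset α) : Prop :=
  ∀ τ ⊆ T, τ.card = k + 2 → ∀ ρ ⊆ T, ρ.card = k + 2 →
    ∃ w ∈ S (g.Φ A) (k + 1), d (k + 1) k w =
      ∑ v ∈ τ, g.toFun k (τ.erase v) + ∑ v ∈ ρ, g.toFun k (ρ.erase v)

/-- In a sequence of `W` vertices, where `W` is large, there are `Q` vertices whose
`(k + 1)`-simplices have homologous boundaries. -/
theorem exists_homologous (g : SkeletonMap d ε S k α) (hS : Monotone S)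
    (hd : ∀ i j, i ≠ j + 1 → d i j = 0) {b W Q : ℕ} (hW : 0 < W)
    (hcol : ∀ I : Finset ι, I.Nonempty → ∃ col : C k → (Fin b → ZMod 2),
      ∀ z ∈ S I k, ∀ z' ∈ S I k, (∀ j, d k j z = 0) → (∀ j, d k j z' = 0) → col z = col z' →
        ∃ w ∈ S I (k + 1), d (k + 1) k w = z + z')
    (hQ : ∀ col : Finset (Fin W) → (Fin b → ZMod 2), ∃ L : Finset (Fin W), L.card = Q ∧
      ∃ a, ∀ T ⊆ L, T.card = k + 2 → col T = a)
    (e : Fin W → α) (he : Function.Injective e) :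
    ∃ p : Finset (Fin W), p.card = Q ∧ g.Homologous (p.image e) (Finset.univ.image e) := by
  classical
  -- A nonempty vertex set has nonempty `Φ`; in the application the remaining sets then form a
  -- proper subfamily.
  obtain ⟨col, hcol⟩ := hcol (g.Φ (Finset.univ.image e))
    ((g.Φ_nonempty (e ⟨0, hW⟩)).mono (g.Φ_mono (by simp)))
  obtain ⟨p, hp, a, ha⟩ := hQ fun T =>
    col (∑ v ∈ T.image e, g.toFun k ((T.image e).erase v))
  have key (τ : Finset α) (hτ : τ ⊆ p.image e) (hτc : τ.card = k + 2) :
      col (∑ v ∈ τ, g.toFun k (τ.erase v)) = a := by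
    obtain ⟨T, hT, rfl⟩ := Finset.subset_image_iff.mp hτ
    exact ha T hT (by rw [← hτc, Finset.card_image_of_injective _ he])
  have hsub : p.image e ⊆ Finset.univ.image e := Finset.image_subset_image (Finset.subset_univ p)
  refine ⟨p, hp, fun τ hτ hτc ρ hρ hρc => ?_⟩
  exact hcol _ (g.sum_erase_mem hS hτc (hτ.trans hsub)) _
    (g.sum_erase_mem hS hρc (hρ.trans hsub)) (g.d_sum_erase hd hτc) (g.d_sum_erase hd hρc)
    ((key τ hτ hτc).trans (key ρ hρ hρc).symm)

/-- If the `(k + 1)`-simplices in `T` have homologous boundaries, then a chain of an even number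
of them has a boundary whose image bounds. -/
theorem Homologous.exists_d_eq {g : SkeletonMap d ε S k α} {T A : Finset α}
    (h : g.Homologous T A) {c : Finset α →₀ ZMod 2}
    (hc : c ∈ formalChainsOn fun τ => τ ⊆ T ∧ τ.card = k + 2) (hcount : formalCount c = 0) :
    ∃ w ∈ S (g.Φ A) (k + 1), d (k + 1) k w = g.lin k (formalBoundary c) := by
  classical
  by_cases hne : ∃ τ₀ ⊆ T, τ₀.card = k + 2
  · obtain ⟨τ₀, hτ₀, hτ₀c⟩ := hne
    -- Modulo boundaries every simplex contributes the class of the fixed `τ₀`, so the class of the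
    -- whole is `formalCount c` times it.
    have key : g.lin k (formalBoundary c) + formalCount c • ∑ v ∈ τ₀, g.toFun k (τ₀.erase v) ∈
        (S (g.Φ A) (k + 1)).map (d (k + 1) k) := by
      refine map_mem_of_mem_formalChainsOn
        (f := g.lin k ∘ₗ formalBoundary +
          (LinearMap.toSpanSingleton (ZMod 2) _ (∑ v ∈ τ₀, g.toFun k (τ₀.erase v))) ∘ₗ formalCount)
        (fun τ hτ => ?_) hc
      rw [LinearMap.add_apply, LinearMap.comp_apply, LinearMap.comp_apply,
        lin_formalBoundary_single, formalCount_single, LinearMap.toSpanSingleton_apply, one_smul]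
      exact h τ hτ.1 hτ.2 τ₀ hτ₀ hτ₀c
    rw [hcount, zero_smul, add_zero] at key
    exact key
  · have : c = 0 := by
      have := map_mem_of_mem_formalChainsOn (f := LinearMap.id) (S := ⊥)
        (fun τ hτ => absurd ⟨τ, hτ⟩ hne) hc
      simpa using this
    exact ⟨0, Submodule.zero_mem _, by simp [this]⟩

/-- Extension to the next skeleton of a smaller simplex with vertex set `β`, given places in `α`
for the barycentres of its faces and, for each face `A`, a larger set `J A` of vertices of `α` that
contains the barycentres of the faces of `A`. -/
theorem nonempty_succ (g : SkeletonMap d ε S k α) (hS : Monotone S) {β : Type} [DecidableEq β]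
    (place : Finset β → α) (hplace : Function.Injective place) (J : Finset β → Finset α)
    (hJ_empty : J ∅ = ∅) (hJ_inter : ∀ A B, J (A ∩ B) = J A ∩ J B)
    (hJ_place : ∀ ρ, ρ.Nonempty → place ρ ∈ J ρ)
    (hJ : ∀ σ : Finset β, σ.card = k + 2 → ∃ T A : Finset α,
      (∀ ρ ⊆ σ, ρ.Nonempty → place ρ ∈ T) ∧ A ⊆ J σ ∧ g.Homologous T A) :
    Nonempty (SkeletonMap d ε S (k + 1) β) := by
  classical
  have J_mono {A B : Finset β} (h : A ⊆ B) : J A ⊆ J B := by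
    rw [← Finset.inter_eq_left.mpr h, hJ_inter]
    exact Finset.inter_subset_right
  have hw (σ : Finset β) : ∃ w : C (k + 1), σ.card = k + 2 → w ∈ S (g.Φ (J σ)) (k + 1) ∧
      d (k + 1) k w = ∑ v ∈ σ, g.lin k (formalSubdivision place (σ.erase v)) := by
    by_cases hσ : σ.card = k + 2
    · obtain ⟨T, A, hT, hA, hom⟩ := hJ σ hσ
      obtain ⟨w, hwS, hdw⟩ := hom.exists_d_eq (c := formalSubdivision place σ)
        (formalChainsOn_mono (fun τ hτ => ⟨fun x hx => by
          obtain ⟨ρ, hρ, hne, rfl⟩ := hτ.2 x hx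
          exact hT ρ hρ hne, by rw [hτ.1, hσ]⟩) (formalSubdivision_mem hplace σ))
        (formalCount_formalSubdivision_eq_zero place (by omega))
      refine ⟨w, fun _ => ⟨hS (g.Φ_mono hA) _ hwS, ?_⟩⟩
      rw [hdw, formalBoundary_formalSubdivision hplace, map_sum]
    · exact ⟨0, fun h => absurd h hσ⟩
  choose w hw using hw
  let f : ∀ m, Finset β → C m :=
    -- Up to dimension `k` the new map is `g` after subdivision; in dimension `k + 1` it is the
    -- chosen filling.
    Function.update (fun m σ => g.lin m (formalSubdivision place σ)) (k + 1) w
  have f_succ : f (k + 1) = w := Function.update_self ..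
  have f_of_le {m : ℕ} (hm : m ≤ k) : f m = fun σ => g.lin m (formalSubdivision place σ) :=
    Function.update_of_ne (by omega) ..
  refine ⟨{
    toFun := f
    Φ := fun A => g.Φ (J A)
    Φ_empty := by rw [hJ_empty, g.Φ_empty]
    Φ_inter := fun A B => by rw [hJ_inter, g.Φ_inter]
    Φ_nonempty := fun v => (g.Φ_nonempty (place {v})).mono
      (g.Φ_mono (Finset.singleton_subset_iff.mpr (hJ_place _ (Finset.singleton_nonempty v))))
    d_toFun := fun m σ hσ hm => ?_
    toFun_mem := fun m σ hσ hm => ?_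
    augmentation_toFun := fun v => ?_ }⟩
  · rcases Nat.lt_or_ge k (m + 1) with h | h
    · obtain rfl : m = k := by omega
      rw [f_succ, f_of_le le_rfl]
      exact (hw σ hσ).2
    · rw [f_of_le h, f_of_le (by omega), g.d_lin h, formalBoundary_formalSubdivision hplace,
        map_sum]
      exact formalChainsOn_mono (fun τ hτ => hτ.1.trans hσ) (formalSubdivision_mem hplace σ)
  · rcases Nat.lt_or_ge k m with h | h
    · obtain rfl : m = k + 1 := by omega
      rw [f_succ]
      exact (hw σ hσ).1
    · rw [f_of_le h]
      refine map_mem_of_mem_formalChainsOn (fun τ hτ => ?_) (formalSubdivision_mem hplace σ)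
      rw [lin_single]
      refine hS (g.Φ_mono fun x hx => ?_) m (g.toFun_mem m τ (hτ.1.trans hσ) h)
      obtain ⟨ρ, hρ, hne, rfl⟩ := hτ.2 x hx
      exact J_mono hρ (hJ_place ρ hne)
  · rw [f_of_le (Nat.zero_le k)]
    dsimp only
    rw [formalSubdivision_singleton, lin_single]
    exact g.augmentation_toFun _

end SkeletonMap

/-! ### The induction on dimension -/

/-- For families of sufficiently many sets there is a map on the `k`-skeleton of a simplex. -/
theorem exists_nonempty_skeletonMap (b k N : ℕ) :
    ∃ h : ℕ, ∀ {C : ℕ → Type u} [∀ k, AddCommGroup (C k)] [∀ k, Module (ZMod 2) (C k)]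
      (d : ∀ i j, C i →ₗ[ZMod 2] C j) (ε : C 0 →ₗ[ZMod 2] ZMod 2) (n : ℕ)
      (S : Finset (Fin n) → ∀ k, Submodule (ZMod 2) (C k)), h ≤ n → Monotone S →
      (∀ i j, i ≠ j + 1 → d i j = 0) →
      (∀ I : Finset (Fin n), I.Nonempty → ∃ c ∈ S I 0, ε c = 1) →
      (∀ i < k, ∀ I : Finset (Fin n), I.Nonempty → ∃ col : C i → (Fin b → ZMod 2),
        ∀ z ∈ S I i, ∀ z' ∈ S I i, (∀ j, d i j z = 0) → (∀ j, d i j z' = 0) → col z = col z' →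
          ∃ w ∈ S I (i + 1), d (i + 1) i w = z + z') →
      Nonempty (SkeletonMap d ε S k (Fin N)) := by
  classical
  induction k generalizing N with
  | zero =>
    exact ⟨N, fun d ε n S hn _ _ hpt _ => nonempty_skeletonMap_zero d ε hn S hpt⟩
  | succ k ih =>
    -- A `(k + 1)`-simplex has `2 ^ (k + 2) - 1` nonempty faces, each with a barycentre to place.
    -- Sequences of length `W + 1` are used below so that they are nonempty.
    obtain ⟨W, hW⟩ := Finset.exists_monochromatic.{0} (Fin b → ZMod 2) (k + 2) (2 ^ (k + 2) - 1)
    have hW' (col : Finset (Fin (W + 1)) → Fin b → ZMod 2) : ∃ L : Finset (Fin (W + 1)),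
        L.card = 2 ^ (k + 2) - 1 ∧ ∃ a, ∀ T ⊆ L, T.card = k + 2 → col T = a := by
      obtain ⟨L, -, hL⟩ := hW Finset.univ (by simp) col
      exact ⟨L, hL⟩
    obtain ⟨p₀, hp₀, -⟩ := hW' 0
    let κ := {p : Finset (Fin (W + 1)) // p.card = 2 ^ (k + 2) - 1}
    have : Nonempty κ := ⟨⟨p₀, hp₀⟩⟩
    obtain ⟨M, hM⟩ := exists_strictMono_comp_eq κ (W + 1) (FlagRoom N (W + 1))
    obtain ⟨h, hh⟩ := ih M
    refine ⟨h, fun d ε n S hn hS hd hpt hcol => ?_⟩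
    obtain ⟨g⟩ := hh d ε n S hn hS hd hpt fun i hi => hcol i (by omega)
    have hhom (e : Fin (W + 1) → Fin M) : ∃ p : κ, Function.Injective e →
        g.Homologous (p.1.image e) (Finset.univ.image e) := by
      by_cases he : Function.Injective e
      · obtain ⟨p, hpc, hp⟩ := g.exists_homologous hS hd W.succ_pos
          (hcol k (Nat.lt_succ_self k)) hW' e he
        exact ⟨⟨p, hpc⟩, fun _ => hp⟩
      · exact ⟨⟨p₀, hp₀⟩, fun h => absurd h he⟩
    choose P hP using hhom
    obtain ⟨j, hj, p, hp⟩ := hM P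
    -- Each point belongs to a single face, so these vertex sets respect intersections; points of
    -- the empty face are discarded to get `J ∅ = ∅`.
    refine g.nonempty_succ hS (fun ρ => j (FlagRoom.barycentre ρ))
      (hj.injective.comp FlagRoom.barycentre_injective)
      (fun A => (Finset.univ.filter fun y : FlagRoom N (W + 1) =>
        y.face ⊆ A ∧ y.face.Nonempty).image j) ?_ ?_ ?_ ?_
    · rw [Finset.image_eq_empty, Finset.filter_eq_empty_iff]
      rintro y - ⟨hy, hne⟩
      exact hne.ne_empty (Finset.subset_empty.mp hy)
    · intro A B
      rw [← Finset.image_inter _ _ hj.injective, ← Finset.filter_and]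
      congr 1
      refine Finset.filter_congr fun y _ => ?_
      rw [Finset.subset_inter_iff]
      tauto
    · intro ρ hρ
      exact Finset.mem_image_of_mem _ (by simpa using hρ)
    · intro σ hσ
      -- The good positions in a sequence depend on the sequence, yet `e` is built from them.
      -- Homogeneity breaks the circle: they are `p` for every increasing sequence.
      obtain ⟨e, he, hface, hbary⟩ := FlagRoom.exists_strictMono σ p.1
        (Finset.card_pos.mp (by omega)) (by rw [hσ, p.2])
      have hom := hP (j ∘ e) (hj.comp he).injective
      rw [hp e he] at hom
      refine ⟨_, _, fun ρ hρ hne => ?_, ?_, hom⟩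
      · obtain ⟨x, hx, hxρ⟩ := hbary ρ hρ hne
        exact Finset.mem_image.mpr ⟨x, hx, congrArg j hxρ⟩
      · intro y hy
        obtain ⟨x, -, rfl⟩ := Finset.mem_image.mp hy
        exact Finset.mem_image_of_mem j (by simpa using hface x)

/-! ### From the skeleton of a simplex to `K` -/

namespace SkeletonMap

variable {X : Type u} [TopologicalSpace X] {V : Type v} [DecidableEq V]
  {K : PreAbstractSimplicialComplex V} {n k : ℕ} {α : Type} [DecidableEq α]

/-- The chain map on a complex of dimension at most `k` obtained by embedding it into the
`k`-skeleton of a simplex. -/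
def toSimplicialToSingular
    {S : Finset (Fin n) → ∀ k, Submodule (ZMod 2) ((SingularMod2.complex X).X k)}
    (g : SkeletonMap (fun i j => ((SingularMod2.complex X).d i j).hom)
      (SingularMod2.augmentation X) S k α)
    (f : V → α) (hf : ∀ σ ∈ K.faces, Set.InjOn f σ) (hk : ∀ σ ∈ K.faces, σ.card ≤ k + 1) :
    SimplicialToSingular K X where
  map m := Finsupp.linearCombination (ZMod 2) fun σ => g.toFun m (σ.1.image f)
  comm m c := by
    have : ((SingularMod2.complex X).d (m + 1) m).hom ∘ₗ
        Finsupp.linearCombination (ZMod 2)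
          (fun σ : K.Simplex (m + 1) => g.toFun (m + 1) (σ.1.image f)) =
        Finsupp.linearCombination (ZMod 2) (fun σ : K.Simplex m => g.toFun m (σ.1.image f)) ∘ₗ
          K.boundary m := by
      ext σ : 2
      have hinj := hf _ σ.2.1
      have hcard := Finset.card_image_of_injOn hinj
      have hle := hk _ σ.2.1
      have hσ := σ.2.2
      have h := g.d_toFun m (σ.1.image f) (by omega) (by omega)
      simp only [LinearMap.comp_apply, Finsupp.lsingle_apply,
        Finsupp.linearCombination_single, one_smul, PreAbstractSimplicialComplex.boundary, map_sum]
      rw [h, Finset.sum_image hinj, ← Finset.sum_coe_sort]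
      refine Finset.sum_congr rfl fun w _ => ?_
      congr 1
      ext x
      simp only [PreAbstractSimplicialComplex.Simplex.facet, Finset.mem_erase, Finset.mem_image]
      constructor
      · rintro ⟨hx, v, hv, rfl⟩
        exact ⟨v, ⟨fun h => hx (congrArg f h), hv⟩, rfl⟩
      · rintro ⟨v, ⟨hvw, hv⟩, rfl⟩
        exact ⟨fun h => hvw (hinj hv w.2 h), v, hv, rfl⟩
    exact LinearMap.congr_fun this c

end SkeletonMap

theorem propositionp {V : Type v} [DecidableEq V] (K : PreAbstractSimplicialComplex V)
    (hK : K.faces.Finite) (b : ℕ) :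
    ∃ h : ℕ, ∀ (X : Type u) [TopologicalSpace X] (n : ℕ) (U : Fin n → Set X), h ≤ n →
      (∀ G : Finset (Fin n), G ⊂ Finset.univ →
        (⋂ j ∈ G, U j).Nonempty ∧
          ∀ i : ℕ, (i : WithBot ℕ∞) < K.dim →
            SingularMod2.betti i ↥(⋂ j ∈ G, U j) ≤ b) →
      ∃ γ : SimplicialToSingular K X, γ.Nontrivial ∧ γ.ConstrainedBy U := by
  classical
  let vertices : Finset V := hK.toFinset.sup id
  have hvert (σ : Finset V) (hσ : σ ∈ K.faces) : σ ⊆ vertices :=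
    Finset.le_sup (f := id) (hK.mem_toFinset.mpr hσ)
  -- The extra vertex provides a default value even when `K` has no vertices.
  let f (v : V) : Fin (vertices.card + 1) :=
    if h : v ∈ vertices then (vertices.equivFin ⟨v, h⟩).castSucc else 0
  have hf : Set.InjOn f vertices := by
    intro v hv w hw h
    simp only [f, dif_pos (Finset.mem_coe.mp hv), dif_pos (Finset.mem_coe.mp hw)] at h
    exact congrArg Subtype.val (vertices.equivFin.injective (Fin.castSucc_injective _ h))
  -- The dimension of `K`, or `0` if `K` has no vertices.
  let k := hK.toFinset.sup fun σ => σ.card - 1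
  have hk (σ : Finset V) (hσ : σ ∈ K.faces) : σ.card ≤ k + 1 := by
    have : σ.card - 1 ≤ k :=
      Finset.le_sup (f := fun σ : Finset V => σ.card - 1) (hK.mem_toFinset.mpr hσ)
    omega
  have hdim (i : ℕ) (hi : i < k) : (i : WithBot ℕ∞) < K.dim := by
    obtain ⟨σ, hσ, hiσ⟩ := Finset.lt_sup_iff.mp hi
    refine lt_of_lt_of_le ?_ (le_iSup₂ (f := fun (σ : Finset V) (_ : σ ∈ K.faces) =>
      (((σ.card - 1 : ℕ) : ℕ∞) : WithBot ℕ∞)) σ (hK.mem_toFinset.mp hσ))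
    exact_mod_cast hiσ
  obtain ⟨h, hh⟩ := exists_nonempty_skeletonMap.{u} b k (vertices.card + 1)
  refine ⟨h, fun X _ n U hn hU => ?_⟩
  have hproper (I : Finset (Fin n)) (hI : I.Nonempty) : Iᶜ ⊂ Finset.univ := by
    rw [Finset.ssubset_univ_iff]
    intro h
    exact hI.ne_empty (by simpa using congrArg compl h)
  obtain ⟨g⟩ := hh (fun i j => ((SingularMod2.complex X).d i j).hom)
    (SingularMod2.augmentation X) n
    -- Enlarging `I` drops constraints, so the filtration increases with `I`.
    (fun I k => SingularMod2.supportedIn (⋂ i ∈ Iᶜ, U i) k) hn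
    (fun I J hIJ m => SingularMod2.supportedIn_mono
      (Set.biInter_subset_biInter_left fun i hi =>
        Finset.compl_subset_compl.mpr hIJ hi) m)
    (fun i j hij => by
      rw [(SingularMod2.complex X).shape i j fun h => hij h.symm]
      rfl)
    (fun I hI => SingularMod2.exists_mem_supportedIn_augmentation_eq_one (hU _ (hproper I hI)).1)
    (fun i hi I hI => SingularMod2.exists_coloring_of_betti_le _ i b
      ((hU _ (hproper I hI)).2 i (hdim i hi)))
  have hfσ (σ : Finset V) (hσ : σ ∈ K.faces) : Set.InjOn f σ := hf.mono (hvert σ hσ)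
  let γ : SimplicialToSingular K X := g.toSimplicialToSingular f hfσ hk
  have hγ (m : ℕ) (σ : K.Simplex m) : γ.onSimplex σ = g.toFun m (σ.1.image f) := by
    simp [γ, SimplicialToSingular.onSimplex, SkeletonMap.toSimplicialToSingular]
  refine ⟨γ, fun w => ?_, fun σ => g.Φ (σ.image f), ?_, ?_, ?_⟩
  · obtain ⟨v, hv⟩ := Finset.card_eq_one.mp w.2.2
    rw [hγ, hv, Finset.image_singleton]
    exact SingularMod2.odd_card_support (g.augmentation_toFun (f v))
  · rw [Finset.image_empty, g.Φ_empty]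
  · intro σ hσ τ hτ
    rw [← g.Φ_inter, Finset.image_inter_of_injOn]
    rw [← Finset.coe_union]
    exact hf.mono (Finset.union_subset (hvert σ hσ) (hvert τ hτ))
  · intro m σ
    rw [hγ, ← SingularMod2.mem_supportedIn]
    have hcard := Finset.card_image_of_injOn (hfσ _ σ.2.1)
    have hle := hk _ σ.2.1
    have hσ := σ.2.2
    exact g.toFun_mem m _ (by omega) (by omega)

end
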